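/- Let $W=W_0$ be the principal branch of the Lambert function: for $z\in\mathbb{C}$, $W(z)$ is the unique solution $w$ of $we^w=z$ lying in the set of those $w=u+iv$ with $-\pi<v<\pi$ for which $v=0$ and $u\ge -1$, or $v>0$ and $u\ge -v\cot v$, or $v<0$ and $u>-v\cot v$. (Thus $W$ is holomorphic on $\mathbb{C}\setminus(-\infty,-1/e]$, $W(0)=0$, and $W$ maps $(0,\infty)$ onto itself.) A function $g:(0,\infty)\to\mathbb{R}$ is completely monotonic if it is $C^\infty$ and $(-1)^n g^{(n)}(x)\ge 0$ for all $n\ge 0$ and $x>0$. A Bernstein function is a $C^\infty$ function $f:(0,\infty)\to[0,\infty)$ such that $f'$ is completely monotonic; it has a representation $f(x)=a+bx+\int_{(0,\infty)}(1-e^{-x\xi})\,d\nu(\xi)$ for $x>0$, with $a,b\ge 0$ and a positive measure $\nu$ on $(0,\infty)$ (the Lévy measure) such that $\int_{(0,\infty)}\frac{\xi}{1+\xi}\,d\nu(\xi)<\infty$. A Thorin–Bernstein function is a Bernstein function whose Lévy measure has a density $d\nu(t)/dt$ such that $t\,d\nu(t)/dt$ is completely monotonic on $(0,\infty)$. **Theorem.**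 For every $z\in\mathbb{C}$ with $|\arg z|<\pi$ (the value $z=0$ may be included), $$W(z)=\frac1\pi\int_0^\pi \ln\left(1+z\,\frac{\sin v}{v}\,e^{v\cot v}\right)dv,$$ where $\ln$ is the principal branch of the logarithm and the integrand is integrable on $(0,\pi)$. Moreover, $W$ is real-valued on $(0,\infty)$, and its restriction to $(0,\infty)$ is a Thorin–Bernstein function. -/

import Mathlib

open scoped Real ContDiff

/-! ### The principal branch of the Lambert function -/

/-- The range of the principal branch of the Lambert function: the part of the strip
`|Im w| < π` to the right of the curve `Re w = -v cot v`, `v = Im w` (which passes through `-1` at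
`v = 0`), together with the point `-1` and the part of that curve in the upper half-plane. The
map `w ↦ w * exp w` sends this set bijectively onto `ℂ`; the curve (closed up by `-1`) goes to the
branch cut `(-∞, -1/e]`, on which the values of the branch are the limits from above. -/
def lambertRange : Set ℂ :=
  {w | (w.im = 0 ∧ -1 ≤ w.re) ∨
    (0 < w.im ∧ w.im < π ∧ -(w.im * Real.cot w.im) ≤ w.re) ∨
    (-π < w.im ∧ w.im < 0 ∧ -(w.im * Real.cot w.im) < w.re)}

/-- The principal branch `W = W₀` of the Lambert function: `W z` is the solution `w` of
`w * exp w = z` in `lambertRange`. -/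
noncomputable def lambertW (z : ℂ) : ℂ :=
  Function.invFunOn (fun w : ℂ => w * Complex.exp w) lambertRange z

/-! ### Completely monotonic, Bernstein and Thorin–Bernstein functions

Functions on `(0, ∞)` are given as functions on `ℝ` of which only the values on `(0, ∞)` matter. -/

/-- `f : (0, ∞) → ℝ` is completely monotonic. -/
def IsCompletelyMonotonic (f : ℝ → ℝ) : Prop :=
  ContDiffOn ℝ ∞ f (Set.Ioi 0) ∧
    ∀ (n : ℕ) (x : ℝ), 0 < x → 0 ≤ (-1) ^ n * iteratedDeriv n f x

/-- `f : (0, ∞) → [0, ∞)` is a Bernstein function. -/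
def IsBernstein (f : ℝ → ℝ) : Prop :=
  (∀ x : ℝ, 0 < x → 0 ≤ f x) ∧ ContDiffOn ℝ ∞ f (Set.Ioi 0) ∧ IsCompletelyMonotonic (deriv f)

/-- The Lévy–Khintchine representation `f x = a + b x + ∫ (1 - exp (-x ξ)) dν(ξ)`, `x > 0`, with
`a, b ≥ 0` and with Lévy measure `ν` on `(0, ∞)`, `∫ ξ / (1 + ξ) dν(ξ) < ∞`. -/
def HasLevyKhintchine (f : ℝ → ℝ) (a b : ℝ) (ν : MeasureTheory.Measure ℝ) : Prop :=
  0 ≤ a ∧ 0 ≤ b ∧ ν (Set.Iic 0) = 0 ∧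
    MeasureTheory.lintegral ν (fun ξ => ENNReal.ofReal (ξ / (1 + ξ))) < ⊤ ∧
    ∀ x : ℝ, 0 < x → f x = a + b * x + ∫ ξ, (1 - Real.exp (-(x * ξ))) ∂ν

/-- `f` is a Thorin–Bernstein function: a Bernstein function whose Lévy measure has a density
`m` on `(0, ∞)` such that `t * m t` is completely monotonic. -/
def IsThorinBernstein (f : ℝ → ℝ) : Prop :=
  IsBernstein f ∧
    ∃ (a b : ℝ) (ν : MeasureTheory.Measure ℝ), HasLevyKhintchine f a b ν ∧
      ∃ m : ℝ → ℝ, IsCompletelyMonotonic (fun t => t * m t) ∧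
        ν = (MeasureTheory.volume.restrict (Set.Ioi (0 : ℝ))).withDensity
          (fun t => ENNReal.ofReal (m t))

open scoped Real ContDiff

/-! Write κ for `kernel` and F for `lambertIntegral`. Since 0 < κ ≤ e, F is complex differentiable
at every point outside (-∞, 0), and Im F(z) is the mean of arg(1 + z κ(s)) over s in (0, π).

The map w ↦ w e^w sends the point of height v on the curve Re w = -v cot v to the real number
-1/κ(v). As κ is strictly decreasing, 1 - κ(s)/κ(v) has argument π for s < v and 0 for s ≥ v, so the
mean, taken with limits from above, is exactly v. On the real edge of the range all the arguments
vanish. Hence H(w) = F(w e^w) - w has bounded imaginary part on `upperRange`, with boundary limit 0.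
A Phragmén–Lindelöf argument gives Im H = 0, the open mapping theorem makes H constant, and the
behaviour at 0 makes the constant 0 (`lambertIntegral_mul_exp_of_mem_upperRange`). Conjugation and
continuity give the lower half and the nonnegative reals. So F is a left inverse of w e^w, and
surjectivity (`exists_mem_lambertRange`) identifies it with W.

On (0, ∞) the derivative is the mean of κ/(1 + xκ), which is completely monotonic. Frullani's
integral writes log(1 + xκ) as ∫ (1 - e^{-xt}) e^{-t/κ} dt/t; by Fubini the Lévy density m satisfies
t m(t) = mean of e^{-t/κ}, again completely monotonic. -/

namespace Lambert

open MeasureTheory Set Filter Topology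

/-! ### Completely monotonic functions -/

/-- A function that starts a sequence of nonnegative functions on `(0, ∞)`, each of which is minus
the derivative of the preceding one, is completely monotonic. -/
theorem isCompletelyMonotonic_of_hasDerivAt {A : ℕ → ℝ → ℝ}
    (hA : ∀ n x, 0 < x → HasDerivAt (A n) (-A (n + 1) x) x) (hpos : ∀ n x, 0 < x → 0 ≤ A n x)
    {f : ℝ → ℝ} (hf : ∀ x, 0 < x → f x = A 0 x) : IsCompletelyMonotonic f := by
  constructor
  · have key : ∀ n k : ℕ, ContDiffOn ℝ n (A k) (Ioi 0) := by
      intro n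
      induction n with
      | zero =>
        intro k
        exact contDiffOn_zero.2 fun x hx => (hA k x hx).continuousAt.continuousWithinAt
      | succ n ih =>
        intro k
        push_cast
        rw [contDiffOn_succ_iff_deriv_of_isOpen isOpen_Ioi]
        refine ⟨fun x hx => (hA k x hx).differentiableAt.differentiableWithinAt, by simp, ?_⟩
        exact (ih (k + 1)).neg.congr fun x hx => (hA k x hx).deriv
    exact contDiffOn_infty.2 fun n => (key n 0).congr hf
  · have key : ∀ n x, 0 < x → iteratedDeriv n f x = (-1) ^ n * A n x := by
      intro n
      induction n with
      | zero => intro x hx; simp [hf x hx]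
      | succ n ih =>
        intro x hx
        have h : iteratedDeriv n f =ᶠ[𝓝 x] fun y => (-1) ^ n * A n y := by
          filter_upwards [lt_mem_nhds hx] with y hy using ih y hy
        rw [iteratedDeriv_succ, h.deriv_eq, ((hA n x hx).const_mul _).deriv, pow_succ]
        ring
    intro n x hx
    rw [key n x hx, ← mul_assoc, ← mul_pow]
    simpa using hpos n x hx

/-! ### Integrals over a finite measure depending on a parameter -/

section Integrals

variable {α : Type*} [MeasurableSpace α] {μ : Measure α} [IsFiniteMeasure μ] {φ : α → ℝ} {M : ℝ}

/-- The derivative of φ/(1 + xφ) in x is minus its own square, so each differentiation raises the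
power by one; the bound M on φ dominates every power. -/
theorem hasDerivAt_integral_div_pow (hφ : Measurable φ) (hM : ∀ᵐ v ∂μ, 0 < φ v ∧ φ v ≤ M)
    (n : ℕ) {x : ℝ} (hx : 0 < x) :
    HasDerivAt (fun x : ℝ => ∫ v, (φ v / (1 + x * φ v)) ^ (n + 1) ∂μ)
      (-((n + 1) * ∫ v, (φ v / (1 + x * φ v)) ^ (n + 2) ∂μ)) x := by
  have hb : ∀ᵐ v ∂μ, ∀ y ∈ Ioi (0 : ℝ), 0 < φ v / (1 + y * φ v) ∧ φ v / (1 + y * φ v) ≤ M := by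
    filter_upwards [hM] with v hv y hy
    have hy : (0 : ℝ) < y := hy
    have h1 : 0 < y * φ v := mul_pos hy hv.1
    refine ⟨div_pos hv.1 (by linarith), (div_le_self hv.1.le (by linarith)).trans hv.2⟩
  have hmeas : ∀ (k : ℕ) (y : ℝ), AEStronglyMeasurable (fun v => (φ v / (1 + y * φ v)) ^ k) μ :=
    fun k y => (by fun_prop : Measurable _).aestronglyMeasurable
  have h := hasDerivAt_integral_of_dominated_loc_of_deriv_le (μ := μ) (x₀ := x)
    (F := fun y v => (φ v / (1 + y * φ v)) ^ (n + 1))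
    (F' := fun y v => -((n + 1) * (φ v / (1 + y * φ v)) ^ (n + 2)))
    (bound := fun _ => (n + 1) * M ^ (n + 2)) (Ioi_mem_nhds hx)
    (Eventually.of_forall fun y => hmeas _ y) ?_ ((hmeas _ x).const_mul _).neg ?_
    (integrable_const _) ?_
  · exact h.2.congr_deriv (by rw [integral_neg, integral_const_mul])
  · refine Integrable.of_bound (hmeas _ x) (M ^ (n + 1)) ?_
    filter_upwards [hb] with v hv
    rw [Real.norm_of_nonneg (pow_nonneg (hv x hx).1.le _)]
    exact pow_le_pow_left₀ (hv x hx).1.le (hv x hx).2 _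
  · filter_upwards [hb] with v hv y hy
    rw [norm_neg, Real.norm_of_nonneg (mul_nonneg (by positivity) (pow_nonneg (hv y hy).1.le _))]
    have := pow_le_pow_left₀ (hv y hy).1.le (hv y hy).2 (n + 2)
    gcongr
  · filter_upwards [hM] with v hv y hy
    have hy : (0 : ℝ) < y := hy
    have h1 : 1 + y * φ v ≠ 0 := by have := mul_pos hy hv.1; linarith
    have h2 : HasDerivAt (fun y : ℝ => 1 + y * φ v) (φ v) y := by
      simpa using ((hasDerivAt_id y).mul_const (φ v)).const_add 1
    refine (((hasDerivAt_const y (φ v)).fun_div h2 h1).fun_pow (n + 1)).congr_deriv ?_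
    have h3 : (0 * (1 + y * φ v) - φ v * φ v) / (1 + y * φ v) ^ 2 =
        -(φ v / (1 + y * φ v)) ^ 2 := by
      rw [div_pow]
      ring
    rw [Nat.add_sub_cancel, h3]
    push_cast
    ring

theorem isCompletelyMonotonic_integral_div (hφ : Measurable φ)
    (hM : ∀ᵐ v ∂μ, 0 < φ v ∧ φ v ≤ M) {c : ℝ} (hc : 0 ≤ c) {f : ℝ → ℝ}
    (hf : ∀ x, 0 < x → f x = c * ∫ v, φ v / (1 + x * φ v) ∂μ) : IsCompletelyMonotonic f := by
  refine isCompletelyMonotonic_of_hasDerivAt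
    (A := fun n x => c * (n.factorial * ∫ v, (φ v / (1 + x * φ v)) ^ (n + 1) ∂μ)) ?_ ?_ ?_
  · intro n x hx
    refine (((hasDerivAt_integral_div_pow hφ hM n hx).const_mul _).const_mul c).congr_deriv ?_
    push_cast [Nat.factorial_succ]
    ring
  · intro n x hx
    refine mul_nonneg hc (mul_nonneg (by positivity) (integral_nonneg_of_ae ?_))
    filter_upwards [hM] with v hv
    have := hv.1
    simp only [Pi.zero_apply]
    positivity
  · intro x hx
    simp [hf x hx]

/-- A single Taylor term of exp(at) is at most exp(at). -/
theorem pow_mul_exp_neg_le (n : ℕ) {a t : ℝ} (ha : 0 < a) (ht : 0 ≤ t) :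
    t ^ n * Real.exp (-(a * t)) ≤ n.factorial / a ^ n := by
  have h := Real.pow_div_factorial_le_exp (a * t) (by positivity) n
  rw [Real.exp_neg, ← div_eq_mul_inv, div_le_div_iff₀ (Real.exp_pos _) (by positivity)]
  rw [div_le_iff₀ (by positivity)] at h
  calc t ^ n * a ^ n = (a * t) ^ n := by ring
    _ ≤ _ := h
    _ = _ := by ring

/-- No upper bound on τ is assumed: the application has τ = 1/φ, which may be unbounded. The
domination is therefore only local, on y > x/2, where the exponential absorbs the powers of τ. -/
theorem hasDerivAt_integral_pow_mul_exp {τ : α → ℝ} (hτ : Measurable τ) (hpos : ∀ᵐ v ∂μ, 0 ≤ τ v)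
    (n : ℕ) {x : ℝ} (hx : 0 < x) :
    HasDerivAt (fun x : ℝ => ∫ v, τ v ^ n * Real.exp (-(x * τ v)) ∂μ)
      (-∫ v, τ v ^ (n + 1) * Real.exp (-(x * τ v)) ∂μ) x := by
  have hmeas : ∀ (k : ℕ) (y : ℝ),
      AEStronglyMeasurable (fun v => τ v ^ k * Real.exp (-(y * τ v))) μ := fun k y => by fun_prop
  have hb : ∀ k : ℕ, ∀ᵐ v ∂μ, ∀ y ∈ Ioi (x / 2),
      ‖τ v ^ k * Real.exp (-(y * τ v))‖ ≤ k.factorial / (x / 2) ^ k := by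
    intro k
    filter_upwards [hpos] with v hv y hy
    have hy : x / 2 < y := hy
    rw [Real.norm_of_nonneg (by positivity)]
    refine le_trans ?_ (pow_mul_exp_neg_le k (half_pos hx) hv)
    gcongr
  have h := hasDerivAt_integral_of_dominated_loc_of_deriv_le (μ := μ) (x₀ := x)
    (F := fun y v => τ v ^ n * Real.exp (-(y * τ v)))
    (F' := fun y v => -(τ v ^ (n + 1) * Real.exp (-(y * τ v))))
    (bound := fun _ => (n + 1).factorial / (x / 2) ^ (n + 1)) (Ioi_mem_nhds (half_lt_self hx))
    (Eventually.of_forall fun y => hmeas _ y) ?_ (hmeas _ x).neg ?_ (integrable_const _) ?_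
  · exact h.2.congr_deriv (integral_neg _)
  · refine Integrable.of_bound (hmeas _ x) (n.factorial / (x / 2) ^ n) ?_
    filter_upwards [hb n] with v hv using hv x (half_lt_self hx)
  · filter_upwards [hb (n + 1)] with v hv y hy
    rw [norm_neg]
    exact hv y hy
  · refine Eventually.of_forall fun v y _ => ?_
    have h2 : HasDerivAt (fun y : ℝ => -(y * τ v)) (-τ v) y := by
      simpa using ((hasDerivAt_id y).mul_const (τ v)).fun_neg
    refine (h2.exp.const_mul (τ v ^ n)).congr_deriv ?_
    ring

theorem isCompletelyMonotonic_integral_exp {τ : α → ℝ} (hτ : Measurable τ)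
    (hpos : ∀ᵐ v ∂μ, 0 ≤ τ v) {c : ℝ} (hc : 0 ≤ c) {f : ℝ → ℝ}
    (hf : ∀ x, 0 < x → f x = c * ∫ v, Real.exp (-(x * τ v)) ∂μ) : IsCompletelyMonotonic f := by
  refine isCompletelyMonotonic_of_hasDerivAt
    (A := fun n x => c * ∫ v, τ v ^ n * Real.exp (-(x * τ v)) ∂μ) ?_ ?_ ?_
  · intro n x hx
    refine ((hasDerivAt_integral_pow_mul_exp hτ hpos n hx).const_mul c).congr_deriv ?_
    ring
  · intro n x hx
    refine mul_nonneg hc (integral_nonneg_of_ae ?_)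
    filter_upwards [hpos] with v hv
    simp only [Pi.zero_apply]
    positivity
  · intro x hx
    simp [hf x hx]

/-- The set on which `z ↦ ∫ log (1 + z φ)` is holomorphic for `0 < φ ≤ M` is open. -/
theorem eventually_forall_mem_slitPlane {M : ℝ} {z : ℂ}
    (hz : ∀ s ∈ Icc 0 M, 1 + z * (s : ℂ) ∈ Complex.slitPlane) :
    ∀ᶠ y in 𝓝 z, ∀ s ∈ Icc 0 M, 1 + y * (s : ℂ) ∈ Complex.slitPlane := by
  refine isCompact_Icc.eventually_forall_of_forall_eventually fun s hs => ?_
  have hc : Continuous fun p : ℂ × ℝ => 1 + p.1 * (p.2 : ℂ) := by fun_prop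
  exact hc.continuousAt.eventually_mem (Complex.isOpen_slitPlane.mem_nhds (hz s hs))

theorem hasDerivAt_integral_log (hφ : Measurable φ) (hM : ∀ᵐ v ∂μ, 0 < φ v ∧ φ v ≤ M) {z : ℂ}
    (hz : ∀ s ∈ Icc 0 M, 1 + z * (s : ℂ) ∈ Complex.slitPlane) :
    Integrable (fun v => Complex.log (1 + z * (φ v : ℂ))) μ ∧
    HasDerivAt (fun z : ℂ => ∫ v, Complex.log (1 + z * (φ v : ℂ)) ∂μ)
      (∫ v, (φ v : ℂ) / (1 + z * (φ v : ℂ)) ∂μ) z := by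
  -- On the compact set K × [0, M] both the logarithm and its derivative are continuous, hence
  -- bounded; these bounds dominate the integrands.
  obtain ⟨K, hKc, hzK, hK⟩ := exists_compact_subset
    (isOpen_interior (s := {y : ℂ | ∀ s ∈ Icc 0 M, 1 + y * (s : ℂ) ∈ Complex.slitPlane}))
    (mem_interior_iff_mem_nhds.2 (eventually_forall_mem_slitPlane hz))
  have hK : ∀ y ∈ K, ∀ s ∈ Icc 0 M, 1 + y * (s : ℂ) ∈ Complex.slitPlane :=
    fun y hy => interior_subset (hK hy)
  have hKz : K ∈ 𝓝 z := mem_interior_iff_mem_nhds.1 hzK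
  have hlogm : ∀ y : ℂ, AEStronglyMeasurable (fun v => Complex.log (1 + y * (φ v : ℂ))) μ :=
    fun y => (by fun_prop : Measurable fun v => 1 + y * (φ v : ℂ)).clog.aestronglyMeasurable
  have hlin : Continuous fun p : ℂ × ℝ => 1 + p.1 * (p.2 : ℂ) := by fun_prop
  obtain ⟨C₁, hC₁⟩ := (hKc.prod (isCompact_Icc (a := 0) (b := M))).exists_bound_of_continuousOn
    (f := fun p : ℂ × ℝ => Complex.log (1 + p.1 * (p.2 : ℂ)))
    (hlin.continuousOn.clog fun p hp => hK p.1 hp.1 p.2 hp.2)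
  obtain ⟨C₂, hC₂⟩ := (hKc.prod (isCompact_Icc (a := 0) (b := M))).exists_bound_of_continuousOn
    (f := fun p : ℂ × ℝ => (p.2 : ℂ) / (1 + p.1 * (p.2 : ℂ)))
    (ContinuousOn.div (by fun_prop) hlin.continuousOn
      fun p hp => Complex.slitPlane_ne_zero (hK p.1 hp.1 p.2 hp.2))
  have hint : Integrable (fun v => Complex.log (1 + z * (φ v : ℂ))) μ := by
    refine Integrable.of_bound (hlogm z) C₁ ?_
    filter_upwards [hM] with v hv
    exact hC₁ (z, φ v) ⟨mem_of_mem_nhds hKz, hv.1.le, hv.2⟩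
  refine ⟨hint, (hasDerivAt_integral_of_dominated_loc_of_deriv_le (μ := μ) (x₀ := z)
    (F := fun y v => Complex.log (1 + y * (φ v : ℂ)))
    (F' := fun y v => (φ v : ℂ) / (1 + y * (φ v : ℂ)))
    (bound := fun _ => C₂) hKz (Eventually.of_forall hlogm) hint
    (by fun_prop : Measurable _).aestronglyMeasurable ?_
    (integrable_const _) ?_).2⟩
  · filter_upwards [hM] with v hv y hy
    exact hC₂ (y, φ v) ⟨hy, hv.1.le, hv.2⟩
  · filter_upwards [hM] with v hv y hy
    have h2 : HasDerivAt (fun y : ℂ => 1 + y * (φ v : ℂ)) (φ v : ℂ) y := by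
      simpa using ((hasDerivAt_id y).mul_const (φ v : ℂ)).const_add 1
    exact h2.clog (hK y hy (φ v) ⟨hv.1.le, hv.2⟩)

end Integrals

/-! ### Frullani's integral and the Lévy–Khintchine representation -/

theorem one_sub_exp_neg_div_mem {x ξ : ℝ} (hx : 0 ≤ x) (hξ : 0 < ξ) :
    0 ≤ (1 - Real.exp (-(x * ξ))) / ξ ∧ (1 - Real.exp (-(x * ξ))) / ξ ≤ x := by
  constructor
  · refine div_nonneg ?_ hξ.le
    rw [sub_nonneg, Real.exp_le_one_iff]
    have := mul_nonneg hx hξ.le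
    linarith
  · rw [div_le_iff₀ hξ]
    have := Real.add_one_le_exp (-(x * ξ))
    linarith

/-- Frullani's integral for exp(-y) with the rates τ and τ + x, whose value is log((τ + x)/τ). -/
theorem integral_one_sub_exp_div_mul_exp {x τ : ℝ} (hx : 0 < x) (hτ : 0 < τ) :
    ∫ ξ in Ioi (0 : ℝ), (1 - Real.exp (-(x * ξ))) / ξ * Real.exp (-(ξ * τ)) =
      Real.log (1 + x * τ⁻¹) := by
  have hint : IntegrableOn (fun ξ => (1 - Real.exp (-(x * ξ))) / ξ * Real.exp (-(ξ * τ)))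
      (Ioi 0) := by
    refine Integrable.mono' (g := fun ξ => x * Real.exp (-τ * ξ))
      ((integrableOn_exp_mul_Ioi (neg_lt_zero.2 hτ) 0).const_mul x) (by fun_prop) ?_
    filter_upwards [ae_restrict_mem measurableSet_Ioi] with ξ hξ
    have h := one_sub_exp_neg_div_mem hx.le hξ
    rw [norm_mul, Real.norm_of_nonneg h.1, Real.norm_of_nonneg (Real.exp_pos _).le,
      show -(ξ * τ) = -τ * ξ by ring]
    exact mul_le_mul_of_nonneg_right h.2 (Real.exp_pos _).le
  have heq : ∀ ξ : ℝ, ξ⁻¹ • (Real.exp (-(τ * ξ)) - Real.exp (-((τ + x) * ξ))) =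
      (1 - Real.exp (-(x * ξ))) / ξ * Real.exp (-(ξ * τ)) := by
    intro ξ
    rw [show -((τ + x) * ξ) = -(x * ξ) + -(ξ * τ) by ring, Real.exp_add, mul_comm τ ξ, smul_eq_mul]
    ring
  have h := Frullani.integral_Ioi_eq (f := fun y : ℝ => Real.exp (-y)) (a := τ) (b := τ + x)
    (L := 1) (R := 0) ?_ hτ (by linarith) ?_ ?_ ?_
  · simp only [heq] at h
    rw [h]
    simp only [sub_zero, smul_eq_mul, mul_one]
    congr 1
    field_simp
  · exact (by fun_prop : Continuous fun y : ℝ => Real.exp (-y)).locallyIntegrable.locallyIntegrableOn _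
  · have : Tendsto (fun y : ℝ => Real.exp (-y)) (𝓝 0) (𝓝 (Real.exp (-0))) :=
      (by fun_prop : Continuous fun y : ℝ => Real.exp (-y)).tendsto 0
    simpa using this.mono_left nhdsWithin_le_nhds
  · exact Real.tendsto_exp_neg_atTop_nhds_zero
  · simpa only [heq] using hint

/-- Frullani under the integral sign, followed by Fubini. Since 1/φ ≥ 1/M, the inner exponentials
are at most e^{-t/M}, which gives both the Lévy condition and the integrability needed for the
exchange. -/
theorem hasLevyKhintchine_integral_log {α : Type*} [MeasurableSpace α] {μ : Measure α}
    [IsFiniteMeasure μ] {φ : α → ℝ} {M : ℝ} (hφ : Measurable φ)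
    (hM : ∀ᵐ v ∂μ, 0 < φ v ∧ φ v ≤ M) (hM0 : 0 < M) {f : ℝ → ℝ} {c : ℝ} (hc : 0 ≤ c)
    (hf : ∀ x, 0 < x → f x = c * ∫ v, Real.log (1 + x * φ v) ∂μ) :
    HasLevyKhintchine f 0 0 ((volume.restrict (Ioi (0 : ℝ))).withDensity
      fun t => ENNReal.ofReal (c * (∫ v, Real.exp (-(t * (φ v)⁻¹)) ∂μ) / t)) := by
  set k : ℝ → ℝ := fun t => ∫ v, Real.exp (-(t * (φ v)⁻¹)) ∂μ with hk
  have hkm : Measurable k := by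
    have : StronglyMeasurable (Function.uncurry fun (t : ℝ) (v : α) =>
        Real.exp (-(t * (φ v)⁻¹))) := by
      apply Measurable.stronglyMeasurable
      unfold Function.uncurry
      fun_prop
    exact this.integral_prod_right.measurable
  have hk0 : ∀ t, 0 ≤ k t := fun t => integral_nonneg fun v => (Real.exp_pos _).le
  have hexp : ∀ᵐ v ∂μ, ∀ t : ℝ, 0 < t → Real.exp (-(t * (φ v)⁻¹)) ≤ Real.exp (-M⁻¹ * t) := by
    filter_upwards [hM] with v hv t ht
    rw [Real.exp_le_exp, neg_mul, neg_le_neg_iff, mul_comm]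
    have := hv.1
    have := hv.2
    gcongr
  have hkle : ∀ t, 0 < t → k t ≤ μ.real univ * Real.exp (-M⁻¹ * t) := by
    intro t ht
    calc k t ≤ ∫ _, Real.exp (-M⁻¹ * t) ∂μ := by
          refine integral_mono_ae ?_ (integrable_const _) ?_
          · refine Integrable.of_bound (by fun_prop) (Real.exp (-M⁻¹ * t)) ?_
            filter_upwards [hexp] with v hv
            rw [Real.norm_of_nonneg (Real.exp_pos _).le]
            exact hv t ht
          · filter_upwards [hexp] with v hv using hv t ht
      _ = _ := by simp
  have hdm : Measurable fun t => ENNReal.ofReal (c * k t / t) := by fun_prop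
  have hexpint : IntegrableOn (fun t => Real.exp (-M⁻¹ * t)) (Ioi 0) :=
    integrableOn_exp_mul_Ioi (neg_lt_zero.2 (inv_pos.2 hM0)) 0
  refine ⟨le_rfl, le_rfl, ?_, ?_, ?_⟩
  · refine (withDensity_absolutelyContinuous _ _) ?_
    rw [Measure.restrict_apply measurableSet_Iic, Iic_inter_Ioi, Ioc_self, measure_empty]
  · rw [lintegral_withDensity_eq_lintegral_mul _ hdm (by fun_prop)]
    have hfin : IntegrableOn (fun t => c * (μ.real univ * Real.exp (-M⁻¹ * t))) (Ioi 0) :=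
      (hexpint.const_mul _).const_mul _
    refine lt_of_le_of_lt ?_ (hfin.lintegral_lt_top)
    refine lintegral_mono_ae ?_
    filter_upwards [ae_restrict_mem measurableSet_Ioi] with t ht
    have ht : 0 < t := ht
    have h1 : 0 ≤ c * k t / t := div_nonneg (mul_nonneg hc (hk0 t)) ht.le
    rw [Pi.mul_apply, ← ENNReal.ofReal_mul h1]
    refine ENNReal.ofReal_le_ofReal ?_
    calc c * k t / t * (t / (1 + t)) = c * k t / (1 + t) := by field_simp
      _ ≤ c * k t := div_le_self (mul_nonneg hc (hk0 t)) (by linarith)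
      _ ≤ _ := mul_le_mul_of_nonneg_left (hkle t ht) hc
  · intro x hx
    rw [integral_withDensity_eq_integral_toReal_smul hdm (Eventually.of_forall fun _ => by simp)]
    have hstep : ∫ t in Ioi (0 : ℝ), (ENNReal.ofReal (c * k t / t)).toReal •
          (1 - Real.exp (-(x * t))) =
        c * ∫ t in Ioi (0 : ℝ), ∫ v, (1 - Real.exp (-(x * t))) / t * Real.exp (-(t * (φ v)⁻¹)) ∂μ := by
      rw [← integral_const_mul]
      refine setIntegral_congr_fun measurableSet_Ioi fun t ht => ?_
      have ht : 0 < t := ht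
      rw [ENNReal.toReal_ofReal (div_nonneg (mul_nonneg hc (hk0 t)) ht.le), integral_const_mul,
        smul_eq_mul]
      ring
    rw [hstep, integral_integral_swap, hf x hx, zero_mul, zero_add, zero_add]
    · congr 1
      refine integral_congr_ae ?_
      filter_upwards [hM] with v hv
      rw [integral_one_sub_exp_div_mul_exp hx (inv_pos.2 hv.1), inv_inv]
    · refine Integrable.mono' (g := fun p : ℝ × α => x * Real.exp (-M⁻¹ * p.1) * 1)
        (Integrable.mul_prod (f := fun t => x * Real.exp (-M⁻¹ * t)) (g := fun _ : α => (1 : ℝ))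
          (hexpint.const_mul x) (integrable_const _)) ?_ ?_
      · apply Measurable.aestronglyMeasurable
        unfold Function.uncurry
        fun_prop
      · have h1 : ∀ᵐ p ∂((volume.restrict (Ioi (0 : ℝ))).prod μ), 0 < p.1 :=
          Measure.quasiMeasurePreserving_fst.ae (ae_restrict_mem measurableSet_Ioi)
        have h2 := Measure.quasiMeasurePreserving_snd (μ := volume.restrict (Ioi (0 : ℝ))).ae hexp
        filter_upwards [h1, h2] with p hp1 hp2
        have h := one_sub_exp_neg_div_mem hx.le hp1
        simp only [Function.uncurry]
        rw [norm_mul, Real.norm_of_nonneg h.1, Real.norm_of_nonneg (Real.exp_pos _).le, mul_one]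
        exact mul_le_mul h.2 (hp2 _ hp1) (Real.exp_pos _).le hx.le

/-! ### A maximum principle -/

/-- For c > 1 the set where ‖h‖ ≥ c is compact, as it stays away from the frontier and from
infinity. If it is nonempty for some such c, a global maximum is attained; the set of maximum points
is compact, and open by the local maximum principle, so it would be all of ℂ. -/
theorem norm_le_one_of_eventually_frontier {U : Set ℂ} (hU : IsOpen U) {h : ℂ → ℂ}
    (hd : DifferentiableOn ℂ h U)
    (hb : ∀ b ∈ frontier U, ∀ c > 1, ∀ᶠ w in 𝓝[U] b, ‖h w‖ < c)
    (hinf : ∀ c > 1, ∃ R, ∀ w ∈ U, R < ‖w‖ → ‖h w‖ < c) {w : ℂ} (hw : w ∈ U) : ‖h w‖ ≤ 1 := by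
  by_contra! hlt
  have compact : ∀ c > 1, IsCompact {w | w ∈ U ∧ c ≤ ‖h w‖} := by
    intro c hc
    obtain ⟨R, hR⟩ := hinf c hc
    refine Metric.isCompact_of_isClosed_isBounded ?_ ?_
    · refine isClosed_of_closure_subset fun b hbc => ?_
      rw [mem_closure_iff_frequently] at hbc
      have hbU : b ∈ U := by
        by_contra hbU
        have hbf : b ∈ frontier U := by
          rw [hU.frontier_eq]
          exact ⟨mem_closure_iff_frequently.2 (hbc.mono fun _ h => h.1), hbU⟩
        have := eventually_nhdsWithin_iff.1 (hb b hbf c hc)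
        obtain ⟨x, hx1, hx2⟩ := (hbc.and_eventually this).exists
        exact absurd (hx2 hx1.1) (not_lt.2 hx1.2)
      refine ⟨hbU, ?_⟩
      have hcont := ((hd.continuousOn.continuousAt (hU.mem_nhds hbU)).norm)
      by_contra! hlt'
      obtain ⟨x, hx1, hx2⟩ := (hbc.and_eventually (hcont.eventually_lt_const hlt')).exists
      exact absurd hx2 (not_lt.2 hx1.2)
    · refine (Metric.isBounded_closedBall (x := (0 : ℂ)) (r := R)).subset fun w hw => ?_
      rw [mem_closedBall_zero_iff]
      by_contra! hlt'
      exact absurd (hR w hw.1 hlt') (not_lt.2 hw.2)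
  obtain ⟨w₁, hw₁, hmax⟩ := (compact _ hlt).exists_isMaxOn ⟨w, hw, le_rfl⟩
    (hd.continuousOn.norm.mono fun x hx => hx.1)
  have hmaxU : ∀ y ∈ U, ‖h y‖ ≤ ‖h w₁‖ := by
    intro y hy
    rcases le_total ‖h w‖ ‖h y‖ with hle | hle
    · exact hmax ⟨hy, hle⟩
    · exact hle.trans hw₁.2
  have hScpt := compact _ (hlt.trans_le hw₁.2)
  have hSopen : IsOpen {y | y ∈ U ∧ ‖h w₁‖ ≤ ‖h y‖} := by
    rw [isOpen_iff_mem_nhds]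
    intro y hy
    have hUy := hU.mem_nhds hy.1
    have hyeq : ‖h y‖ = ‖h w₁‖ := le_antisymm (hmaxU y hy.1) hy.2
    have hev := Complex.norm_eventually_eq_of_isLocalMax (f := h) (c := y)
      (by filter_upwards [hU.eventually_mem hy.1] with x hx using hd.differentiableAt (hU.mem_nhds hx))
      (by filter_upwards [hUy] with x hx using (hmaxU x hx).trans hy.2)
    filter_upwards [hUy, hev] with x hx1 hx2
    exact ⟨hx1, by rw [hx2, hyeq]⟩
  have huniv := IsClopen.eq_univ ⟨hScpt.isClosed, hSopen⟩ ⟨w₁, hw₁.1, le_rfl⟩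
  exact noncompact_univ ℂ (huniv ▸ hScpt)

/-- Phragmén–Lindelöf: exp(i n H)/(w + 2) has modulus e^{-n Im H}/|w + 2|. Here |w + 2| ≥ 1 keeps
the boundary limits at most 1, and the denominator forces decay at infinity because Im H is bounded.
So e^{-n Im H} ≤ |w + 2| for every n, which is impossible if Im H < 0. -/
theorem im_nonneg_of_tendsto_frontier {U : Set ℂ} (hU : IsOpen U) (hre : ∀ w ∈ U, -1 ≤ w.re)
    {H : ℂ → ℂ} (hH : DifferentiableOn ℂ H U) {C : ℝ} (hC : ∀ w ∈ U, |(H w).im| ≤ C)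
    (hb : ∀ b ∈ frontier U, Tendsto (fun w => (H w).im) (𝓝[U] b) (𝓝 0)) {w : ℂ} (hw : w ∈ U) :
    0 ≤ (H w).im := by
  have hone : ∀ w ∈ U, 1 ≤ ‖w + 2‖ := fun w hw => by
    have := Complex.re_le_norm (w + 2)
    simp only [Complex.add_re, Complex.re_ofNat] at this
    linarith [hre w hw]
  have hnorm : ∀ (n : ℕ) (w : ℂ), ‖Complex.exp (n * (Complex.I * H w)) / (w + 2)‖ =
      Real.exp (-(n * (H w).im)) / ‖w + 2‖ := by
    intro n w
    rw [norm_div, Complex.norm_exp]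
    simp
  have key : ∀ n : ℕ, Real.exp (-(n * (H w).im)) / ‖w + 2‖ ≤ 1 := by
    intro n
    rw [← hnorm]
    refine norm_le_one_of_eventually_frontier hU
      (h := fun w => Complex.exp (n * (Complex.I * H w)) / (w + 2)) ?_ ?_ ?_ hw
    · refine DifferentiableOn.div ((hH.const_mul _).const_mul _).cexp (by fun_prop) ?_
      intro x hx h0
      have := hone x hx
      rw [h0, norm_zero] at this
      linarith
    · intro b hbf c hc
      have ht : Tendsto (fun w => Real.exp (-(n * (H w).im))) (𝓝[U] b) (𝓝 (Real.exp (-(n * 0)))) :=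
        (((hb b hbf).const_mul _).neg).rexp
      rw [mul_zero, neg_zero, Real.exp_zero] at ht
      filter_upwards [ht.eventually_lt_const hc, self_mem_nhdsWithin] with x hx hxU
      rw [hnorm]
      exact (div_le_self (Real.exp_pos _).le (hone x hxU)).trans_lt hx
    · intro c hc
      refine ⟨Real.exp (n * C) + 2, fun x hx hR => ?_⟩
      rw [hnorm]
      have h2 : Real.exp (n * C) < ‖x + 2‖ := by
        have := norm_sub_le (x + 2) 2
        simp only [add_sub_cancel_right, Complex.norm_ofNat] at this
        linarith
      refine lt_trans ?_ hc
      rw [div_lt_one (by linarith [hone x hx])]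
      refine lt_of_le_of_lt ?_ h2
      rw [Real.exp_le_exp, ← mul_neg]
      exact mul_le_mul_of_nonneg_left ((neg_le_abs _).trans (hC x hx)) (Nat.cast_nonneg n)
  by_contra! hneg
  obtain ⟨n, hn⟩ := exists_nat_gt (Real.log ‖w + 2‖ / -(H w).im)
  have h1 := key n
  have hp : 0 < ‖w + 2‖ := by linarith [hone w hw]
  rw [div_le_one hp, ← Real.le_log_iff_exp_le hp] at h1
  rw [div_lt_iff₀ (by linarith)] at hn
  linarith

theorem im_eq_zero_of_tendsto_frontier {U : Set ℂ} (hU : IsOpen U) (hre : ∀ w ∈ U, -1 ≤ w.re)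
    {H : ℂ → ℂ} (hH : DifferentiableOn ℂ H U) {C : ℝ} (hC : ∀ w ∈ U, |(H w).im| ≤ C)
    (hb : ∀ b ∈ frontier U, Tendsto (fun w => (H w).im) (𝓝[U] b) (𝓝 0)) {w : ℂ} (hw : w ∈ U) :
    (H w).im = 0 := by
  refine le_antisymm ?_ (im_nonneg_of_tendsto_frontier hU hre hH hC hb hw)
  have := im_nonneg_of_tendsto_frontier hU hre (H := fun w => -H w) hH.neg
    (by simpa using hC) (fun b hbf => by simpa using (hb b hbf).neg) hw
  simpa using this

/-- Otherwise the image would be a nonempty open subset of the real line in ℂ. -/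
theorem eqOn_const_of_im_eq_zero {U : Set ℂ} (hU : IsOpen U) (hc : IsPreconnected U)
    (hne : U.Nonempty) {H : ℂ → ℂ} (hH : DifferentiableOn ℂ H U) (him : ∀ w ∈ U, (H w).im = 0) :
    ∃ c, ∀ w ∈ U, H w = c := by
  refine ((hH.analyticOnNhd hU).is_constant_or_isOpen hc).resolve_right fun hopen => ?_
  have h1 := hopen U subset_rfl hU
  have h2 : H '' U ⊆ interior (Complex.im ⁻¹' {0}) :=
    interior_maximal (image_subset_iff.2 fun w hw => him w hw) h1
  rw [Complex.interior_preimage_im, interior_singleton, preimage_empty, subset_empty_iff,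
    image_eq_empty] at h2
  exact hne.ne_empty h2

/-! ### The kernel -/

/-- The function `φ v = (sin v / v) exp (v cot v)` of the integral representation. -/
noncomputable def kernel (v : ℝ) : ℝ := Real.sin v / v * Real.exp (v * Real.cot v)

theorem measurable_kernel : Measurable kernel := by
  unfold kernel
  simp only [Real.cot_eq_cos_div_sin]
  fun_prop

theorem mul_cos_le_sin {v : ℝ} (h0 : 0 < v) (hπ : v < π) : v * Real.cos v ≤ Real.sin v := by
  have hs := Real.sin_pos_of_pos_of_lt_pi h0 hπ
  rcases lt_or_ge v (π / 2) with h | h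
  · have hc : 0 < Real.cos v := Real.cos_pos_of_mem_Ioo ⟨by linarith, h⟩
    have := (Real.lt_tan h0 h).le
    rwa [Real.tan_eq_sin_div_cos, le_div_iff₀ hc] at this
  · have hc : Real.cos v ≤ 0 := Real.cos_nonpos_of_pi_div_two_le_of_le h (by linarith)
    have := mul_nonpos_of_nonneg_of_nonpos h0.le hc
    linarith

theorem mul_cot_le_one {v : ℝ} (h0 : 0 < v) (hπ : v < π) : v * Real.cot v ≤ 1 := by
  rw [Real.cot_eq_cos_div_sin, ← mul_div_assoc,
    div_le_one (Real.sin_pos_of_pos_of_lt_pi h0 hπ)]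
  exact mul_cos_le_sin h0 hπ

theorem kernel_pos {v : ℝ} (h0 : 0 < v) (hπ : v < π) : 0 < kernel v :=
  mul_pos (div_pos (Real.sin_pos_of_pos_of_lt_pi h0 hπ) h0) (Real.exp_pos _)

theorem kernel_le {v : ℝ} (h0 : 0 < v) (hπ : v < π) : kernel v ≤ Real.exp 1 := by
  have h1 : Real.sin v / v ≤ 1 := (div_le_one h0).2 (Real.sin_le h0.le)
  calc kernel v ≤ 1 * Real.exp 1 :=
        mul_le_mul h1 (Real.exp_le_exp.2 (mul_cot_le_one h0 hπ)) (Real.exp_pos _).le zero_le_one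
    _ = _ := one_mul _

theorem strictAntiOn_kernel : StrictAntiOn kernel (Ioo 0 π) := by
  have hlog : StrictAntiOn (fun v : ℝ => Real.log (Real.sin v) - Real.log v +
      v * (Real.cos v / Real.sin v)) (Ioo 0 π) := by
    have hd : ∀ v ∈ Ioo 0 π, HasDerivAt (fun v : ℝ => Real.log (Real.sin v) - Real.log v +
        v * (Real.cos v / Real.sin v))
        -- The logarithmic derivative of the kernel, written as minus a sum of two squares to make
        -- its sign visible.
        (-((Real.sin v - v * Real.cos v) ^ 2 + (v * Real.sin v) ^ 2) / (v * Real.sin v ^ 2)) v := by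
      rintro v ⟨h0, hπ⟩
      have hs := Real.sin_pos_of_pos_of_lt_pi h0 hπ
      refine ((((Real.hasDerivAt_sin v).log hs.ne').fun_sub (Real.hasDerivAt_log h0.ne')).fun_add
        ((hasDerivAt_id v).fun_mul
          ((Real.hasDerivAt_cos v).fun_div (Real.hasDerivAt_sin v) hs.ne'))).congr_deriv ?_
      simp only [id]
      field_simp
      ring
    refine strictAntiOn_of_deriv_neg (convex_Ioo _ _)
      (fun v hv => (hd v hv).continuousAt.continuousWithinAt) fun v hv => ?_
    rw [interior_Ioo] at hv
    rw [(hd v hv).deriv]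
    have hs := Real.sin_pos_of_pos_of_lt_pi hv.1 hv.2
    have := hv.1
    refine div_neg_of_neg_of_pos ?_ (by positivity)
    have : 0 < (v * Real.sin v) ^ 2 := by positivity
    nlinarith [sq_nonneg (Real.sin v - v * Real.cos v)]
  have heq : ∀ v ∈ Ioo 0 π, kernel v = Real.exp (Real.log (Real.sin v) - Real.log v +
      v * (Real.cos v / Real.sin v)) := by
    rintro v ⟨h0, hπ⟩
    rw [Real.exp_add, Real.exp_sub, Real.exp_log (Real.sin_pos_of_pos_of_lt_pi h0 hπ),
      Real.exp_log h0, kernel, Real.cot_eq_cos_div_sin]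
  intro a ha b hb hab
  rw [heq a ha, heq b hb, Real.exp_lt_exp]
  exact hlog ha hb hab

theorem kernel_mem_ae : ∀ᵐ v ∂volume.restrict (Ioo 0 π), 0 < kernel v ∧ kernel v ≤ Real.exp 1 := by
  filter_upwards [ae_restrict_mem measurableSet_Ioo] with v hv
  exact ⟨kernel_pos hv.1 hv.2, kernel_le hv.1 hv.2⟩

/-! ### The upper half of the range of the principal branch -/

/-- The part of the interior of `lambertRange` in the upper half-plane. -/
def upperRange : Set ℂ :=
  {w | 0 < w.im ∧ w.im < π ∧ 0 < w.re * Real.sin w.im + w.im * Real.cos w.im}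

/-- Multiplication by sin v > 0 removes the cotangent. The resulting expression is continuous on the
whole plane and is the factor that carries the sign of Im(w e^w). -/
theorem mem_upperRange_iff {w : ℂ} :
    w ∈ upperRange ↔ 0 < w.im ∧ w.im < π ∧ -(w.im * Real.cot w.im) < w.re := by
  refine and_congr_right fun h0 => and_congr_right fun hπ => ?_
  have hs := Real.sin_pos_of_pos_of_lt_pi h0 hπ
  rw [Real.cot_eq_cos_div_sin, ← mul_div_assoc, ← neg_div, div_lt_iff₀ hs]
  constructor <;> intro h <;> linarith

theorem isOpen_upperRange : IsOpen upperRange := by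
  have h1 : IsOpen {w : ℂ | 0 < w.im} := isOpen_lt continuous_const Complex.continuous_im
  have h2 : IsOpen {w : ℂ | w.im < π} := isOpen_lt Complex.continuous_im continuous_const
  have h3 : IsOpen {w : ℂ | 0 < w.re * Real.sin w.im + w.im * Real.cos w.im} :=
    isOpen_lt continuous_const (by fun_prop)
  exact h1.inter (h2.inter h3)

theorem neg_one_le_re_of_mem_upperRange {w : ℂ} (hw : w ∈ upperRange) : -1 ≤ w.re := by
  obtain ⟨h0, hπ, h⟩ := mem_upperRange_iff.1 hw
  linarith [mul_cot_le_one h0 hπ]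

/-- The region is the continuous image, under a horizontal shear, of the convex set (0, ∞) × (0, π).
-/
theorem isPreconnected_upperRange : IsPreconnected upperRange := by
  have himg : upperRange = (fun p : ℝ × ℝ =>
      ((p.1 - p.2 * (Real.cos p.2 / Real.sin p.2) : ℝ) : ℂ) + (p.2 : ℂ) * Complex.I) ''
      (Ioi 0 ×ˢ Ioo 0 π) := by
    ext w
    rw [mem_upperRange_iff, Real.cot_eq_cos_div_sin]
    constructor
    · rintro ⟨h0, hπ, h⟩
      refine ⟨(w.re + w.im * (Real.cos w.im / Real.sin w.im), w.im), ⟨?_, h0, hπ⟩, ?_⟩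
      · rw [mem_Ioi]
        linarith
      · simp only [add_sub_cancel_right, Complex.re_add_im]
    · rintro ⟨⟨s, v⟩, ⟨hs, h0, hπ⟩, rfl⟩
      have hs : 0 < s := hs
      simp only [Complex.add_re, Complex.add_im, Complex.ofReal_re, Complex.ofReal_im,
        Complex.re_ofReal_mul, Complex.im_ofReal_mul, Complex.I_re, Complex.I_im, mul_zero, mul_one,
        zero_add, add_zero]
      exact ⟨h0, hπ, by linarith⟩
  rw [himg]
  refine ((convex_Ioi 0).prod (convex_Ioo 0 π)).isPreconnected.image _ ?_
  have hdiv : ContinuousOn (fun p : ℝ × ℝ => Real.cos p.2 / Real.sin p.2) (Ioi 0 ×ˢ Ioo 0 π) :=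
    ContinuousOn.div (by fun_prop) (by fun_prop)
      fun p hp => (Real.sin_pos_of_pos_of_lt_pi hp.2.1 hp.2.2).ne'
  fun_prop

theorem re_mul_exp (w : ℂ) : (w * Complex.exp w).re =
    Real.exp w.re * (w.re * Real.cos w.im - w.im * Real.sin w.im) := by
  rw [Complex.mul_re, Complex.exp_re, Complex.exp_im]
  ring

theorem im_mul_exp (w : ℂ) : (w * Complex.exp w).im =
    Real.exp w.re * (w.re * Real.sin w.im + w.im * Real.cos w.im) := by
  rw [Complex.mul_im, Complex.exp_re, Complex.exp_im]
  ring

theorem im_mul_exp_pos {w : ℂ} (hw : w ∈ upperRange) : 0 < (w * Complex.exp w).im := by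
  rw [im_mul_exp]
  exact mul_pos (Real.exp_pos _) hw.2.2

/-- This is where the kernel comes from: its negative reciprocal parametrizes the image of the
boundary curve. -/
theorem mul_exp_of_re_eq {w : ℂ} (h0 : 0 < w.im) (hπ : w.im < π)
    (hre : w.re = -(w.im * Real.cot w.im)) :
    w * Complex.exp w = ((-(kernel w.im)⁻¹ : ℝ) : ℂ) := by
  have hs := Real.sin_pos_of_pos_of_lt_pi h0 hπ
  have hre' : w.re = -(w.im * Real.cos w.im / Real.sin w.im) := by
    rw [hre, Real.cot_eq_cos_div_sin, mul_div_assoc]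
  apply Complex.ext
  · rw [re_mul_exp, Complex.ofReal_re, kernel, ← neg_neg (w.im * Real.cot w.im), ← hre,
      Real.exp_neg]
    have h1 : w.re * Real.cos w.im - w.im * Real.sin w.im = -(w.im / Real.sin w.im) := by
      rw [hre']
      field_simp
      linear_combination (-1 : ℝ) * Real.sin_sq_add_cos_sq w.im
    rw [h1, mul_inv, inv_inv, inv_div]
    ring
  · rw [im_mul_exp, Complex.ofReal_im, hre']
    field_simp
    ring

theorem frontier_upperRange {b : ℂ} (hb : b ∈ frontier upperRange) :
    (b.im = 0 ∧ -1 ≤ b.re) ∨ (0 < b.im ∧ b.im < π ∧ b.re = -(b.im * Real.cot b.im)) := by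
  rw [isOpen_upperRange.frontier_eq] at hb
  obtain ⟨hcl, hnot⟩ := hb
  have hclosed : ∀ {f : ℂ → ℝ}, Continuous f → (∀ w ∈ upperRange, 0 ≤ f w) → 0 ≤ f b := by
    intro f hf h
    exact closure_minimal h (isClosed_le continuous_const hf) hcl
  have h0 : 0 ≤ b.im := hclosed Complex.continuous_im fun w hw => hw.1.le
  have hπ : 0 ≤ π - b.im := hclosed (f := fun w => π - w.im) (by fun_prop)
    fun w hw => sub_nonneg.2 hw.2.1.le
  have h1 : 0 ≤ b.re * Real.sin b.im + b.im * Real.cos b.im :=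
    hclosed (f := fun w => w.re * Real.sin w.im + w.im * Real.cos w.im) (by fun_prop)
      fun w hw => hw.2.2.le
  have h2 : 0 ≤ b.re + 1 := hclosed (f := fun w => w.re + 1) (by fun_prop)
    fun w hw => by linarith [neg_one_le_re_of_mem_upperRange hw]
  rcases h0.eq_or_lt with h0 | h0
  · exact Or.inl ⟨h0.symm, by linarith⟩
  -- At height π the third defining expression equals -π, so the closure never reaches that line.
  have hne : b.im ≠ π := by
    intro h
    rw [h, Real.sin_pi, Real.cos_pi] at h1
    linarith [Real.pi_pos]
  have hlt : b.im < π := lt_of_le_of_ne (by linarith) hne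
  have h3 : ¬ 0 < b.re * Real.sin b.im + b.im * Real.cos b.im := fun h => hnot ⟨h0, hlt, h⟩
  have hs := Real.sin_pos_of_pos_of_lt_pi h0 hlt
  refine Or.inr ⟨h0, hlt, ?_⟩
  rw [Real.cot_eq_cos_div_sin, ← mul_div_assoc, ← neg_div, eq_div_iff hs.ne']
  linarith

/-- `w ↦ w exp w` maps `upperRange` onto the upper half-plane. -/
theorem exists_mem_upperRange {z : ℂ} (hz : 0 < z.im) :
    ∃ w ∈ upperRange, w * Complex.exp w = z := by
  -- In polar form, w = u + iv must satisfy arg w = θ - v and |w| e^u = r, that is u = v cot(θ - v)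
  -- and v e^u = r sin(θ - v). Eliminating u leaves one real equation for v, solved by the
  -- intermediate value theorem.
  set θ := z.arg with hθ
  set r := ‖z‖ with hr
  have hr0 : 0 < r := norm_pos_iff.2 fun h => by simp [h] at hz
  have hθ0 : 0 < θ := by
    have h1 : 0 ≤ θ := Complex.arg_nonneg_iff.2 hz.le
    refine lt_of_le_of_ne h1 fun h => ?_
    rw [eq_comm, hθ, Complex.arg_eq_zero_iff] at h
    linarith [h.2]
  have hθπ : θ < π := Complex.arg_lt_pi_iff.2 (Or.inr hz.ne')
  -- Chosen so that at v = θ - δ the left side is at least θ - δ ≥ θ/2 ≥ rδ ≥ r sin δ.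
  set δ := θ / (2 * (1 + r)) with hδ
  have hδ0 : 0 < δ := by positivity
  have hδ1 : δ * (2 * (1 + r)) = θ := by rw [hδ]; field_simp
  have hδθ : δ ≤ θ / 2 := by nlinarith
  have hrδ : r * δ ≤ θ / 2 := by nlinarith
  have hsin : ∀ v ∈ Icc 0 (θ - δ), 0 < Real.sin (θ - v) := fun v hv =>
    Real.sin_pos_of_pos_of_lt_pi (by linarith [hv.2]) (by linarith [hv.1])
  have hcont : ContinuousOn (fun v => v * Real.exp (v * (Real.cos (θ - v) / Real.sin (θ - v))) -
      r * Real.sin (θ - v)) (Icc 0 (θ - δ)) := by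
    have : ContinuousOn (fun v => Real.cos (θ - v) / Real.sin (θ - v)) (Icc 0 (θ - δ)) :=
      ContinuousOn.div (by fun_prop) (by fun_prop) fun v hv => (hsin v hv).ne'
    fun_prop
  obtain ⟨v, hv, hveq⟩ : (0 : ℝ) ∈ (fun v => v * Real.exp (v * (Real.cos (θ - v) /
      Real.sin (θ - v))) - r * Real.sin (θ - v)) '' Icc 0 (θ - δ) := by
    refine intermediate_value_Icc (by linarith) hcont ⟨?_, ?_⟩
    · have := mul_pos hr0 (Real.sin_pos_of_pos_of_lt_pi hθ0 hθπ)
      simp only [zero_mul, sub_zero, zero_sub]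
      linarith
    · simp only [sub_sub_cancel]
      have hc : 0 ≤ Real.cos δ := Real.cos_nonneg_of_mem_Icc ⟨by linarith, by linarith⟩
      have hs : 0 < Real.sin δ := Real.sin_pos_of_pos_of_lt_pi hδ0 (by linarith)
      have h1 : 1 ≤ Real.exp ((θ - δ) * (Real.cos δ / Real.sin δ)) :=
        Real.one_le_exp (mul_nonneg (by linarith) (div_nonneg hc hs.le))
      have h2 : r * Real.sin δ ≤ r * δ := mul_le_mul_of_nonneg_left (Real.sin_le hδ0.le) hr0.le
      have h3 := le_mul_of_one_le_right (by linarith : 0 ≤ θ - δ) h1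
      linarith
  have hs := hsin v hv
  have hveq : v * Real.exp (v * (Real.cos (θ - v) / Real.sin (θ - v))) = r * Real.sin (θ - v) := by
    simpa [sub_eq_zero] using hveq
  have hv0 : 0 < v := by
    refine lt_of_le_of_ne hv.1 fun h => ?_
    have := mul_pos hr0 hs
    rw [← hveq, ← h, zero_mul] at this
    exact lt_irrefl _ this
  have hvπ : v < π := by linarith [hv.2]
  set u := v * (Real.cos (θ - v) / Real.sin (θ - v)) with hu
  have hθs : u * Real.sin v + v * Real.cos v = v / Real.sin (θ - v) * Real.sin θ := by
    rw [hu]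
    have : Real.sin θ = Real.sin ((θ - v) + v) := by ring_nf
    rw [this, Real.sin_add]
    field_simp
    ring
  have hθc : u * Real.cos v - v * Real.sin v = v / Real.sin (θ - v) * Real.cos θ := by
    rw [hu]
    have : Real.cos θ = Real.cos ((θ - v) + v) := by ring_nf
    rw [this, Real.cos_add]
    field_simp
  have hexp : Real.exp u * (v / Real.sin (θ - v)) = r := by
    rw [← mul_div_assoc, mul_comm, hveq]
    field_simp
  refine ⟨⟨u, v⟩, ⟨hv0, hvπ, ?_⟩, ?_⟩
  · rw [hθs]
    exact mul_pos (div_pos hv0 hs) (Real.sin_pos_of_pos_of_lt_pi hθ0 hθπ)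
  · apply Complex.ext
    · rw [re_mul_exp]
      simp only [hθc, ← mul_assoc, hexp]
      exact Complex.norm_mul_cos_arg z
    · rw [im_mul_exp]
      simp only [hθs, ← mul_assoc, hexp]
      exact Complex.norm_mul_sin_arg z

/-! ### The integral -/

/-- The integral representing the principal branch. -/
noncomputable def lambertIntegral (z : ℂ) : ℂ :=
  (1 / (π : ℂ)) * ∫ v in Ioo 0 π, Complex.log (1 + z * (kernel v : ℂ))

/-- The condition on z says that z is not in (-∞, 0), in the form produced by
`Complex.arg_lt_pi_iff`; it allows z = 0. -/
theorem one_add_mul_mem_slitPlane {z : ℂ} (hz : 0 ≤ z.re ∨ z.im ≠ 0) {s : ℝ} (hs : 0 ≤ s) :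
    1 + z * (s : ℂ) ∈ Complex.slitPlane := by
  rw [Complex.mem_slitPlane_iff]
  simp only [Complex.add_re, Complex.one_re, Complex.re_mul_ofReal, Complex.add_im, Complex.one_im,
    Complex.im_mul_ofReal, zero_add]
  rcases hs.eq_or_lt with rfl | hs
  · simp
  rcases hz with hz | hz
  · left
    positivity
  · right
    exact mul_ne_zero hz hs.ne'

theorem integrable_log {z : ℂ} (hz : 0 ≤ z.re ∨ z.im ≠ 0) :
    IntegrableOn (fun v => Complex.log (1 + z * (kernel v : ℂ))) (Ioo 0 π) :=
  (hasDerivAt_integral_log measurable_kernel kernel_mem_ae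
    fun _ hs => one_add_mul_mem_slitPlane hz hs.1).1

theorem hasDerivAt_lambertIntegral {z : ℂ} (hz : 0 ≤ z.re ∨ z.im ≠ 0) :
    HasDerivAt lambertIntegral
      ((1 / (π : ℂ)) * ∫ v in Ioo 0 π, (kernel v : ℂ) / (1 + z * (kernel v : ℂ))) z :=
  (hasDerivAt_integral_log measurable_kernel kernel_mem_ae
    fun _ hs => one_add_mul_mem_slitPlane hz hs.1).2.const_mul _

theorem lambertIntegral_zero : lambertIntegral 0 = 0 := by
  simp [lambertIntegral]

theorem lambertIntegral_conj {z : ℂ} (hz : 0 ≤ z.re ∨ z.im ≠ 0) :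
    lambertIntegral (starRingEnd ℂ z) = starRingEnd ℂ (lambertIntegral z) := by
  rw [lambertIntegral, lambertIntegral, map_mul, ← integral_conj, map_div₀, map_one,
    Complex.conj_ofReal]
  congr 1
  refine setIntegral_congr_fun measurableSet_Ioo fun v hv => ?_
  have h := one_add_mul_mem_slitPlane hz (kernel_pos hv.1 hv.2).le
  rw [← Complex.log_conj _ (Complex.mem_slitPlane_iff_arg.1 h).1]
  simp

/-! ### Boundary values of the imaginary part -/

/-- The imaginary part of `lambertIntegral`, with its boundary values from the upper half-plane. -/
noncomputable def argIntegral (z : ℂ) : ℝ :=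
  (1 / π) * ∫ v in Ioo 0 π, Complex.arg (1 + z * (kernel v : ℂ))

theorem im_lambertIntegral {z : ℂ} (hz : 0 ≤ z.re ∨ z.im ≠ 0) :
    (lambertIntegral z).im = argIntegral z := by
  rw [lambertIntegral, argIntegral, ← Complex.ofReal_one, ← Complex.ofReal_div,
    Complex.im_ofReal_mul]
  congr 1
  have h := integral_im (integrable_log hz)
  simpa [Complex.log_im] using h.symm

theorem abs_argIntegral_le (z : ℂ) : |argIntegral z| ≤ π := by
  have h := norm_setIntegral_le_of_norm_le_const (μ := volume) (s := Ioo 0 π)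
    (f := fun v => Complex.arg (1 + z * (kernel v : ℂ))) (C := π)
    (by simp) (fun v _ => Complex.abs_arg_le_pi _)
  rw [Real.norm_eq_abs, Real.volume_real_Ioo_of_le Real.pi_pos.le, sub_zero] at h
  rw [argIntegral, abs_mul, abs_of_pos (by positivity : 0 < 1 / π)]
  calc 1 / π * _ ≤ 1 / π * (π * π) := by gcongr
    _ = π := by field_simp

theorem continuousWithinAt_arg_im_nonneg {p : ℂ} (him : p.im = 0) (hre : p.re ≠ 0) :
    ContinuousWithinAt Complex.arg {z : ℂ | 0 ≤ z.im} p := by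
  rcases hre.lt_or_gt with h | h
  · exact Complex.continuousWithinAt_arg_of_re_neg_of_im_zero h him
  · exact (Complex.continuousAt_arg (Or.inl h)).continuousWithinAt

/-- From the closed upper half-plane, arg is continuous at every real point except 0. Injectivity of
the kernel leaves at most one v with 1 + x κ(v) = 0, a null set, and π dominates. -/
theorem tendsto_argIntegral (x : ℝ) :
    Tendsto argIntegral (𝓝[{z | 0 ≤ z.im}] (x : ℂ)) (𝓝 (argIntegral x)) := by
  refine Tendsto.const_mul _ ?_
  refine tendsto_integral_filter_of_dominated_convergence (fun _ => π) ?_ ?_ (integrable_const _) ?_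
  · refine Eventually.of_forall fun z => ?_
    have := measurable_kernel
    exact (Complex.measurable_arg.comp (by fun_prop : Measurable fun v =>
      1 + z * (kernel v : ℂ))).aestronglyMeasurable
  · exact Eventually.of_forall fun z => Eventually.of_forall fun v => Complex.abs_arg_le_pi _
  · have hne : ∀ᵐ v ∂volume.restrict (Ioo 0 π), 1 + x * kernel v ≠ 0 := by
      have hsub : {v | v ∈ Ioo 0 π ∧ 1 + x * kernel v = 0}.Subsingleton := by
        rintro a ⟨ha, ha'⟩ b ⟨hb, hb'⟩
        refine strictAntiOn_kernel.injOn ha hb ?_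
        have hx : x ≠ 0 := by
          rintro rfl
          simp at ha'
        exact mul_left_cancel₀ hx (by linarith)
      rw [ae_restrict_iff' measurableSet_Ioo, ae_iff]
      convert hsub.measure_zero volume using 2
      ext v
      simp [and_assoc]
    filter_upwards [hne, ae_restrict_mem measurableSet_Ioo] with v hv hmem
    have hk := kernel_pos hmem.1 hmem.2
    have hmaps : MapsTo (fun z : ℂ => 1 + z * (kernel v : ℂ)) {z | 0 ≤ z.im} {z | 0 ≤ z.im} := by
      intro z hz
      have hz : 0 ≤ z.im := hz
      simpa using mul_nonneg hz hk.le
    have hc : ContinuousWithinAt (fun z : ℂ => 1 + z * (kernel v : ℂ)) {z | 0 ≤ z.im} (x : ℂ) := by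
      fun_prop
    exact (ContinuousWithinAt.comp (t := {z : ℂ | 0 ≤ z.im})
      (continuousWithinAt_arg_im_nonneg (by simp) (by simpa using hv)) hc hmaps).tendsto

theorem neg_exp_neg_one_le_mul_exp (u : ℝ) : -Real.exp (-1) ≤ u * Real.exp u := by
  have h := Real.add_one_le_exp (-1 - u)
  have h2 : Real.exp (-1) = Real.exp (-1 - u) * Real.exp u := by
    rw [← Real.exp_add]
    ring_nf
  rw [h2]
  nlinarith [Real.exp_pos u]

/-- On the real edge, x ≥ -1/e and κ ≤ e make every argument 0. On the curve, monotonicity of κ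
makes the argument π times the indicator of (0, Im b), up to a single point where arg 0 = 0. -/
theorem argIntegral_of_mem_frontier {b : ℂ} (hb : b ∈ frontier upperRange) :
    ∃ x : ℝ, b * Complex.exp b = x ∧ argIntegral x = b.im := by
  rcases frontier_upperRange hb with ⟨him, -⟩ | ⟨h0, hπ, hre⟩
  · refine ⟨b.re * Real.exp b.re, ?_, ?_⟩
    · have : b = (b.re : ℂ) := Complex.ext (by simp) (by simpa using him)
      rw [this]
      push_cast
      simp
    · rw [him, argIntegral, setIntegral_eq_zero_of_forall_eq_zero, mul_zero]
      intro v hv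
      rw [← Complex.ofReal_mul, ← Complex.ofReal_one, ← Complex.ofReal_add, Complex.arg_ofReal_of_nonneg]
      have h1 := neg_exp_neg_one_le_mul_exp b.re
      have h2 := kernel_pos hv.1 hv.2
      have h3 := kernel_le hv.1 hv.2
      have h4 : Real.exp (-1) * Real.exp 1 = 1 := by rw [← Real.exp_add]; simp
      nlinarith [Real.exp_pos (-1)]
  · refine ⟨-(kernel b.im)⁻¹, mul_exp_of_re_eq h0 hπ hre, ?_⟩
    have hkb := kernel_pos h0 hπ
    have harg : ∀ v ∈ Ioo 0 π, Complex.arg (1 + ((-(kernel b.im)⁻¹ : ℝ) : ℂ) * (kernel v : ℂ)) =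
        (Ioo 0 b.im).indicator (fun _ => π) v := by
      intro v hv
      rw [← Complex.ofReal_mul, ← Complex.ofReal_one, ← Complex.ofReal_add]
      have hfrac : 1 + -(kernel b.im)⁻¹ * kernel v = (kernel b.im - kernel v) / kernel b.im := by
        field_simp
        ring
      rw [hfrac]
      rcases lt_or_ge v b.im with hlt | hge
      · rw [indicator_of_mem (show v ∈ Ioo 0 b.im from ⟨hv.1, hlt⟩)]
        exact Complex.arg_ofReal_of_neg
          (div_neg_of_neg_of_pos (sub_neg.2 (strictAntiOn_kernel hv ⟨h0, hπ⟩ hlt)) hkb)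
      · rw [indicator_of_notMem (fun h => absurd h.2 (not_lt.2 hge))]
        exact Complex.arg_ofReal_of_nonneg
          (div_nonneg (sub_nonneg.2 (strictAntiOn_kernel.antitoneOn ⟨h0, hπ⟩ hv hge)) hkb.le)
    rw [argIntegral, setIntegral_congr_fun measurableSet_Ioo harg,
      setIntegral_indicator measurableSet_Ioo, Ioo_inter_Ioo]
    simp only [max_self, min_eq_right hπ.le, setIntegral_const, Real.volume_real_Ioo_of_le h0.le,
      sub_zero, smul_eq_mul]
    field_simp

/-! ### The integral inverts `w ↦ w exp w` -/

theorem lambertIntegral_mul_exp_of_mem_upperRange {w : ℂ} (hw : w ∈ upperRange) :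
    lambertIntegral (w * Complex.exp w) = w := by
  set H : ℂ → ℂ := fun w => lambertIntegral (w * Complex.exp w) - w with hHdef
  have hmem : ∀ w ∈ upperRange, 0 ≤ (w * Complex.exp w).re ∨ (w * Complex.exp w).im ≠ 0 :=
    fun w hw => Or.inr (im_mul_exp_pos hw).ne'
  have hH : DifferentiableOn ℂ H upperRange := by
    intro w hw
    refine DifferentiableAt.differentiableWithinAt ?_
    have h1 : DifferentiableAt ℂ (fun w : ℂ => w * Complex.exp w) w := by fun_prop
    exact ((hasDerivAt_lambertIntegral (hmem w hw)).differentiableAt.comp w h1).sub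
      differentiableAt_id
  have him : ∀ w ∈ upperRange, (H w).im = argIntegral (w * Complex.exp w) - w.im := by
    intro w hw
    rw [hHdef, Complex.sub_im, im_lambertIntegral (hmem w hw)]
  have hbound : ∀ w ∈ upperRange, |(H w).im| ≤ π + π := by
    intro w hw
    rw [him w hw]
    refine (abs_sub _ _).trans (add_le_add (abs_argIntegral_le _) ?_)
    rw [abs_of_pos hw.1]
    exact hw.2.1.le
  have hfront : ∀ b ∈ frontier upperRange, Tendsto (fun w => (H w).im) (𝓝[upperRange] b) (𝓝 0) := by
    intro b hb
    obtain ⟨x, hx, hxb⟩ := argIntegral_of_mem_frontier hb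
    have h1 : Tendsto (fun w : ℂ => w * Complex.exp w) (𝓝[upperRange] b)
        (𝓝[{z | 0 ≤ z.im}] (x : ℂ)) := by
      refine tendsto_nhdsWithin_iff.2 ⟨?_, ?_⟩
      · rw [← hx]
        exact ((by fun_prop : Continuous fun w : ℂ => w * Complex.exp w).tendsto b).mono_left
          nhdsWithin_le_nhds
      · filter_upwards [self_mem_nhdsWithin] with w hw using (im_mul_exp_pos hw).le
    have h2 : Tendsto Complex.im (𝓝[upperRange] b) (𝓝 b.im) :=
      (Complex.continuous_im.tendsto b).mono_left nhdsWithin_le_nhds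
    have h3 := ((tendsto_argIntegral x).comp h1).sub h2
    rw [hxb, sub_self] at h3
    refine h3.congr' ?_
    filter_upwards [self_mem_nhdsWithin] with w hw using (him w hw).symm
  obtain ⟨c, hc⟩ := eqOn_const_of_im_eq_zero isOpen_upperRange isPreconnected_upperRange ⟨w, hw⟩ hH
    fun w hw => im_eq_zero_of_tendsto_frontier isOpen_upperRange
      (fun _ => neg_one_le_re_of_mem_upperRange) hH hbound hfront hw
  -- The constant is found by approaching 0 along the positive imaginary axis, which lies in
  -- `upperRange` near 0; F is continuous at 0 and vanishes there.
  have hlim : Tendsto (fun t : ℝ => H (t * Complex.I)) (𝓝[>] 0) (𝓝 0) := by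
    have h1 : ContinuousAt H 0 := by
      have h2 : ContinuousAt lambertIntegral (0 * Complex.exp 0) := by
        rw [zero_mul]
        exact (hasDerivAt_lambertIntegral (by simp)).continuousAt
      exact (ContinuousAt.comp (f := fun w : ℂ => w * Complex.exp w) h2 (by fun_prop)).sub
        continuousAt_id
    have h3 : Tendsto (fun t : ℝ => (t : ℂ) * Complex.I) (𝓝[>] 0) (𝓝 0) := by
      have := (by fun_prop : Continuous fun t : ℝ => (t : ℂ) * Complex.I).tendsto 0
      rw [Complex.ofReal_zero, zero_mul] at this
      exact this.mono_left nhdsWithin_le_nhds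
    have h4 := h1.tendsto.comp h3
    simpa [hHdef, lambertIntegral_zero, Function.comp_def] using h4
  have hconst : Tendsto (fun t : ℝ => H (t * Complex.I)) (𝓝[>] 0) (𝓝 c) := by
    refine tendsto_const_nhds.congr' ?_
    filter_upwards [Ioo_mem_nhdsGT (half_pos Real.pi_pos)] with t ht
    have hcos : 0 < Real.cos t := Real.cos_pos_of_mem_Ioo ⟨by linarith [ht.1, Real.pi_pos], ht.2⟩
    refine (hc _ ⟨?_, ?_, ?_⟩).symm
    · simpa using ht.1
    · simpa using ht.2.trans (half_lt_self Real.pi_pos)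
    · simpa using mul_pos ht.1 hcos
  have hc0 := tendsto_nhds_unique hlim hconst
  have := hc w hw
  rw [← hc0] at this
  exact sub_eq_zero.1 this

theorem lambertIntegral_mul_exp_ofReal {u : ℝ} (hu : 0 ≤ u) :
    lambertIntegral (u * Complex.exp u) = u := by
  have h0 : 0 ≤ ((u : ℂ) * Complex.exp u).re := by
    rw [← Complex.ofReal_exp, ← Complex.ofReal_mul, Complex.ofReal_re]
    positivity
  have hseq : Tendsto (fun t : ℝ => (u : ℂ) + t * Complex.I) (𝓝[>] 0) (𝓝 u) := by
    have := (by fun_prop : Continuous fun t : ℝ => (u : ℂ) + t * Complex.I).tendsto 0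
    rw [Complex.ofReal_zero, zero_mul, add_zero] at this
    exact this.mono_left nhdsWithin_le_nhds
  have hcont : ContinuousAt (fun w : ℂ => lambertIntegral (w * Complex.exp w)) u :=
    ContinuousAt.comp (f := fun w : ℂ => w * Complex.exp w)
      (hasDerivAt_lambertIntegral (Or.inl h0)).continuousAt (by fun_prop)
  refine tendsto_nhds_unique (hcont.tendsto.comp hseq) (hseq.congr' ?_)
  filter_upwards [Ioo_mem_nhdsGT (half_pos Real.pi_pos)] with t ht
  have hcos : 0 < Real.cos t := Real.cos_pos_of_mem_Ioo ⟨by linarith [ht.1, Real.pi_pos], ht.2⟩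
  have hsin : 0 < Real.sin t := Real.sin_pos_of_pos_of_lt_pi ht.1 (by linarith [ht.2, ht.1])
  refine (lambertIntegral_mul_exp_of_mem_upperRange ⟨?_, ?_, ?_⟩).symm
  · simpa using ht.1
  · simpa using ht.2.trans (half_lt_self Real.pi_pos)
  · have h1 := mul_pos ht.1 hcos
    have h2 := mul_nonneg hu hsin.le
    simpa using add_pos_of_nonneg_of_pos h2 h1

/-! ### Conjugation symmetry and identification with W -/

theorem mul_exp_conj (w : ℂ) : starRingEnd ℂ w * Complex.exp (starRingEnd ℂ w) =
    starRingEnd ℂ (w * Complex.exp w) := by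
  rw [Complex.exp_conj, map_mul]

theorem mem_lambertRange_of_mem_upperRange {w : ℂ} (hw : w ∈ upperRange) : w ∈ lambertRange := by
  obtain ⟨h0, hπ, h⟩ := mem_upperRange_iff.1 hw
  exact Or.inr (Or.inl ⟨h0, hπ, h.le⟩)

theorem cot_neg (v : ℝ) : Real.cot (-v) = -Real.cot v := by
  rw [Real.cot_eq_cos_div_sin, Real.cot_eq_cos_div_sin, Real.cos_neg, Real.sin_neg, div_neg]

theorem conj_mem_upperRange_iff {w : ℂ} : starRingEnd ℂ w ∈ upperRange ↔
    -π < w.im ∧ w.im < 0 ∧ -(w.im * Real.cot w.im) < w.re := by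
  rw [mem_upperRange_iff, Complex.conj_im, Complex.conj_re, cot_neg, neg_mul_neg]
  constructor
  · rintro ⟨h1, h2, h3⟩
    exact ⟨by linarith, by linarith, h3⟩
  · rintro ⟨h1, h2, h3⟩
    exact ⟨by linarith, by linarith, h3⟩

theorem exists_mem_lambertRange {z : ℂ} (hz : 0 ≤ z.re ∨ z.im ≠ 0) :
    ∃ w ∈ lambertRange, w * Complex.exp w = z := by
  rcases lt_trichotomy z.im 0 with him | him | him
  · obtain ⟨w, hw, hwz⟩ := exists_mem_upperRange (z := starRingEnd ℂ z) (by simpa using him)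
    refine ⟨starRingEnd ℂ w, Or.inr (Or.inr (conj_mem_upperRange_iff.1 (by simpa using hw))), ?_⟩
    rw [mul_exp_conj, hwz, Complex.conj_conj]
  · have hre : 0 ≤ z.re := hz.resolve_right (not_not.2 him)
    have hcont : ContinuousOn (fun u : ℝ => u * Real.exp u) (Icc 0 z.re) := by fun_prop
    obtain ⟨u, hu, huz⟩ := intermediate_value_Icc hre hcont
      (show z.re ∈ Icc _ _ from ⟨by simpa using hre,
        le_mul_of_one_le_right hre (Real.one_le_exp hre)⟩)
    refine ⟨u, Or.inl ⟨by simp, ?_⟩, ?_⟩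
    · rw [Complex.ofReal_re]
      linarith [hu.1]
    · rw [← Complex.ofReal_exp, ← Complex.ofReal_mul]
      exact Complex.ext (by rw [Complex.ofReal_re]; exact huz) (by rw [Complex.ofReal_im, him])
  · obtain ⟨w, hw, hwz⟩ := exists_mem_upperRange him
    exact ⟨w, mem_lambertRange_of_mem_upperRange hw, hwz⟩

theorem lambertIntegral_mul_exp {w : ℂ} (hw : w ∈ lambertRange)
    (hz : 0 ≤ (w * Complex.exp w).re ∨ (w * Complex.exp w).im ≠ 0) :
    lambertIntegral (w * Complex.exp w) = w := by
  rcases hw with ⟨him, -⟩ | ⟨h0, hπ, hre⟩ | hw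
  · obtain ⟨u, rfl⟩ : ∃ u : ℝ, w = u := ⟨w.re, Complex.ext (by simp) (by simpa using him)⟩
    refine lambertIntegral_mul_exp_ofReal ?_
    rw [← Complex.ofReal_exp, ← Complex.ofReal_mul, Complex.ofReal_re, Complex.ofReal_im] at hz
    exact nonneg_of_mul_nonneg_left (hz.resolve_right (not_not.2 rfl)) (Real.exp_pos u)
  · rcases hre.eq_or_lt with hre | hre
    -- Points of the curve itself have negative real image, which `hz` excludes.
    · rw [mul_exp_of_re_eq h0 hπ hre.symm, Complex.ofReal_re, Complex.ofReal_im] at hz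
      have := inv_pos.2 (kernel_pos h0 hπ)
      have := hz.resolve_right (not_not.2 rfl)
      linarith
    · exact lambertIntegral_mul_exp_of_mem_upperRange (mem_upperRange_iff.2 ⟨h0, hπ, hre⟩)
  · have hw := conj_mem_upperRange_iff.2 hw
    have h := lambertIntegral_mul_exp_of_mem_upperRange hw
    rw [mul_exp_conj, lambertIntegral_conj hz] at h
    exact (starRingEnd ℂ).injective h

/-- The left inverse F recovers whichever solution `Function.invFunOn` selects, so uniqueness needs
no separate proof. -/
theorem lambertW_eq_lambertIntegral {z : ℂ} (hz : 0 ≤ z.re ∨ z.im ≠ 0) :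
    lambertW z = lambertIntegral z := by
  have hex : ∃ w ∈ lambertRange, (fun w : ℂ => w * Complex.exp w) w = z :=
    exists_mem_lambertRange hz
  have hmem : lambertW z ∈ lambertRange := Function.invFunOn_mem hex
  have heq : lambertW z * Complex.exp (lambertW z) = z := Function.invFunOn_eq hex
  have h := lambertIntegral_mul_exp hmem (by rwa [heq])
  rw [← h, heq]

/-! ### The principal branch on the positive half-line -/

theorem lambertW_ofReal {x : ℝ} (hx : 0 < x) :
    lambertW x = ((1 / π * ∫ v in Ioo 0 π, Real.log (1 + x * kernel v) : ℝ) : ℂ) := by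
  rw [lambertW_eq_lambertIntegral (Or.inl (by simpa using hx.le)), lambertIntegral]
  push_cast
  congr 1
  rw [← integral_complex_ofReal]
  refine setIntegral_congr_fun measurableSet_Ioo fun v hv => ?_
  have := mul_pos hx (kernel_pos hv.1 hv.2)
  rw [Complex.ofReal_log (by linarith)]
  push_cast
  rfl

theorem hasDerivAt_lambertW_re {x : ℝ} (hx : 0 < x) :
    HasDerivAt (fun x : ℝ => (lambertW x).re)
      (1 / π * ∫ v in Ioo 0 π, kernel v / (1 + x * kernel v)) x := by
  have h := (hasDerivAt_lambertIntegral (z := x) (Or.inl (by simpa using hx.le))).real_of_complex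
  refine (h.congr_deriv ?_).congr_of_eventuallyEq ?_
  · rw [← Complex.ofReal_one, ← Complex.ofReal_div, Complex.re_ofReal_mul]
    congr 1
    rw [← Complex.ofReal_re (∫ v in Ioo 0 π, kernel v / (1 + x * kernel v)),
      ← integral_complex_ofReal]
    push_cast
    rfl
  · filter_upwards [lt_mem_nhds hx] with y hy
    rw [lambertW_eq_lambertIntegral (Or.inl (by simpa using hy.le))]

theorem isBernstein_lambertW : IsBernstein (fun x : ℝ => (lambertW x).re) := by
  have hcm : IsCompletelyMonotonic (deriv fun x : ℝ => (lambertW x).re) :=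
    isCompletelyMonotonic_integral_div measurable_kernel kernel_mem_ae
      (by positivity : 0 ≤ 1 / π) fun x hx => (hasDerivAt_lambertW_re hx).deriv
  refine ⟨fun x hx => ?_, ?_, hcm⟩
  · simp only [lambertW_ofReal hx, Complex.ofReal_re]
    refine mul_nonneg (by positivity) (setIntegral_nonneg measurableSet_Ioo fun v hv => ?_)
    have := mul_pos hx (kernel_pos hv.1 hv.2)
    exact Real.log_nonneg (by linarith)
  · rw [contDiffOn_infty_iff_deriv_of_isOpen isOpen_Ioi]
    exact ⟨fun x hx => (hasDerivAt_lambertW_re hx).differentiableAt.differentiableWithinAt, hcm.1⟩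

theorem isThorinBernstein_lambertW : IsThorinBernstein (fun x : ℝ => (lambertW x).re) := by
  refine ⟨isBernstein_lambertW, 0, 0, _,
    hasLevyKhintchine_integral_log measurable_kernel kernel_mem_ae (Real.exp_pos 1)
      (by positivity : 0 ≤ 1 / π) fun x hx => by rw [lambertW_ofReal hx, Complex.ofReal_re],
    _, ?_, rfl⟩
  -- The factor t cancels the 1/t of the Lévy density, leaving a Laplace transform in the variable
  -- 1/κ.
  refine isCompletelyMonotonic_integral_exp measurable_kernel.inv ?_
    (by positivity : 0 ≤ 1 / π) fun t ht => mul_div_cancel₀ _ ht.ne'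
  filter_upwards [kernel_mem_ae] with v hv using (inv_pos.2 hv.1).le

end Lambert

theorem mainTheorem9 :
    (∀ z : ℂ, |Complex.arg z| < π →
      IntervalIntegrable
        (fun v : ℝ => Complex.log
          (1 + z * ((Real.sin v / v * Real.exp (v * Real.cot v) : ℝ) : ℂ)))
        MeasureTheory.volume 0 π ∧
      lambertW z = (1 / (π : ℂ)) *
        ∫ v in (0 : ℝ)..π, Complex.log
          (1 + z * ((Real.sin v / v * Real.exp (v * Real.cot v) : ℝ) : ℂ))) ∧
    (∀ x : ℝ, 0 < x → (lambertW x).im = 0) ∧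
    IsThorinBernstein (fun x : ℝ => (lambertW x).re) := by
  refine ⟨fun z hz => ?_, fun x hx => ?_, Lambert.isThorinBernstein_lambertW⟩
  · have hz : 0 ≤ z.re ∨ z.im ≠ 0 := Complex.arg_lt_pi_iff.1 ((le_abs_self _).trans_lt hz)
    constructor
    · rw [intervalIntegrable_iff_integrableOn_Ioo_of_le Real.pi_pos.le]
      exact Lambert.integrable_log hz
    · rw [intervalIntegral.integral_of_le Real.pi_pos.le,
        MeasureTheory.integral_Ioc_eq_integral_Ioo]
      exact Lambert.lambertW_eq_lambertIntegral hz
  · rw [Lambert.lambertW_ofReal hx, Complex.ofReal_im]
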